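/- **Conventions.** On $\mathbb{C}$ let $d(z,w)=\max\{|\mathrm{Re}(z-w)|,|\mathrm{Im}(z-w)|\}$, let $B(z,r)$ be the open ball of $d$ (a square box of radius $r$ and side-length $2r$), $B^e(z,r)$ the open Euclidean ball, $\mathcal N(S,r)=\{w:\exists s\in S,\ d(w,s)<r\}$, and $d_H$ the Hausdorff distance for $d$. For $n\in\mathbb{N}$ let $\mathcal S_{n+2}=2^{-n-2}\mathbb{Z}[i]$ (ideal points). For a compact set $C$, a function $h:\mathcal S_{n+2}\to\{0,1\}$ is a *valid* $h_C(n,\cdot)$ if $h(z)=1$ whenever $d(z,C)<2^{-n-2}$ and $h(z)=0$ whenever $d(z,C)\ge 2^{-n-1}$. The *picture* drawn according to $h$ is the union of the closed boxes of radius $2^{-n-3}$ centred at the points where $h=1$; a set $\Psi$ is a $2^{-n}$-*approximation* of $C$ if $d_H(C,\Psi)\le 2^{-n}$. Let $p:\mathbb{C}\to\mathbb{C}$ be a polynomial of degree $d\ge2$, and let $J$ be its Julia set, that is, the boundary of the set of points with bounded orbit. Assume that $p$ is hyperbolic: there are $c_0>0$ and $L_0>1$ with $|(p^n)'(z)|\ge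 c_0L_0^n$ for all $z\in J$, $n\in\mathbb{N}$. **The algorithm.** *Step 1(a).* Choose an integer $\nu\ge1$, dyadic rationals $\delta,\lambda'>0$, a finite collection of closed square boxes of positive radius with pairwise disjoint interiors and with union $\mathcal B$, and a power of two $R=2^m$ ($m\in\mathbb{N}$), such that, with $g=p^\nu$: $J\subset\mathcal B$; $J\subset[-R,R]^2$; $|g'|>1+\lambda'$ on $\mathcal B$; and $2\delta$ is a modulus of continuity of $g'$ on $\mathcal B$ for the tolerance $\lambda'/2$, that is, $|g'(w)-g'(z)|\le\lambda'/2$ for all $z\in\mathcal B$ and $w$ with $d(w,z)<2\delta$. Put $L=1+\lambda'/2$ and $\mathcal N_1=\mathcal N(\mathcal B,2\delta)$; thus $|g'|>L$ on $\mathcal N_1$. *Step 1(b).* Choose any $\gamma\in(0,0.1]$. Put $r=3\delta/4$, let $a\in(0,r)$ satisfy $\gamma=\max\bigl(1-(1+a/r)^{-2},\,(1-a/r)^{-2}-1\bigr)$, and put $c=\frac{(1-3\gamma)(1-\gamma)}{1+\gamma}$ and $b=\min\bigl(\frac{\delta c}{16\sqrt2(1+\gamma)},a\bigr)$. Choose a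 finite collection of closed square boxes (*reference boxes*), all of the same side-length $\beta'\in(0,b)$, with union $\mathcal N_2$, such that $J\subset\mathcal N_2$, each reference box meets $J$, $|g'|>L$ on $\mathcal N_2$, and $\mathcal N(\mathcal N_2,\delta)\subset\mathcal N_1$. *Step 1(c).* Choose $N'\in\mathbb{N}$ with $2^{-N'-1}<a$ and $2^{-N'}<\delta$. Given $N\ge N'$ and $z\in\mathcal S_{N+2}$, the value reported for $z$ is the one given by the first of the following tests that applies: - if $z\notin[-R-1,R+1]^2$, report $0$; - (d) if $\overline{B(z,2^{-N-2})}\cap\mathcal N_2=\emptyset$, report $0$; - (e) if some reference box is contained in $B(z,2^{-N-1})$, report $1$; - (f) if $2^{-N-2}>\beta'\sqrt2$, report $0$. *Step 2.* Otherwise put $\sigma_N=2^{-N-3}$ and $k_N=\left\lceil\frac{1}{\log_2L}\left(N+3+\log_2\frac{2\beta'\sqrt2}{c}\right)\right\rceil$. For $k=1,\dots,k_N$ in turn, let $z_k=g^k(z)$, $D_k=|(g^k)'(z)|$, and run the following tests in this order, stopping at the first one that applies: - (c) if $B^e(z_k,3\sigma_ND_k(1+\gamma))\cap\mathcal N_2=\emptyset$,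 report $0$; - (d) if $B^e(z_k,4\sigma_ND_k(1-\gamma))$ contains a reference box, report $1$; - (e) if $D_k\sigma_Nc>2\beta'\sqrt2$, report $0$. If no test applies for any $k\le k_N$, report $0$ (Step 2(f)). For $N\ge N'$ the drawn picture for precision $N$ is the picture drawn according to the reported values at level $N$; for $N<N'$ it is the one for precision $N'$. **Proposition.** Let $p$ be a hyperbolic polynomial of degree $d\ge2$. Then the choices in Step 1(a) can be made; after any such choices and for every $\gamma\in(0,0.1]$, those in Steps 1(b) and 1(c) can be made. Moreover, for all such choices: 1. for every $N\ge N'$, the values reported by the algorithm define a valid $h_J(N,\cdot)$; 2. for every $N\in\mathbb{N}$, the drawn picture for precision $N$ is a $2^{-N}$-approximation of $J$. -/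

import Mathlib

open Polynomial

noncomputable section

namespace HypJulia

/-! ### The `L^∞` metric on the plane, boxes and neighbourhoods -/

/-- `ℂ` viewed as `ℝ × ℝ`, which carries the `L^∞` metric. -/
def toPlane (z : ℂ) : ℝ × ℝ := (z.re, z.im)

/-- The `L^∞` distance `d(z, w) = max {|Re z - Re w|, |Im z - Im w|}`. -/
def supDist (z w : ℂ) : ℝ := max |z.re - w.re| |z.im - w.im|

theorem supDist_eq (z w : ℂ) : supDist z w = dist (toPlane z) (toPlane w) := by
  simp [supDist, toPlane, Prod.dist_eq, Real.dist_eq]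

/-- The `L^∞` distance `d(z, C)` from a point to a set. -/
def supInfDist (z : ℂ) (C : Set ℂ) : ℝ := Metric.infDist (toPlane z) (toPlane '' C)

/-- The open box `B(z, r)`, with centre `z` and side-length `2 r`. -/
def openBox (z : ℂ) (r : ℝ) : Set ℂ := {w | supDist w z < r}

/-- The closed box with centre `z` and side-length `2 r`. -/
def closedBox (z : ℂ) (r : ℝ) : Set ℂ := {w | supDist w z ≤ r}

/-- The open `L^∞` neighbourhood `𝒩(S, r)` of a set. -/
def nbhd (S : Set ℂ) (r : ℝ) : Set ℂ := {w | ∃ s ∈ S, supDist w s < r}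

/-- Dyadic rationals. -/
def IsDyadic (x : ℝ) : Prop := ∃ (m : ℤ) (k : ℕ), x = m / 2 ^ k

/-! ### Approximations and pictures of a set -/

/-- `Ψ` is a `2^{-n}`-approximation of `C`: their Hausdorff distance, for the `L^∞` metric, is at
most `2^{-n}`. The extended distance is used, so that it is infinite if exactly one set is empty. -/
def IsApproximation (n : ℕ) (C Ψ : Set ℂ) : Prop :=
  Metric.hausdorffEDist (toPlane '' C) (toPlane '' Ψ) ≤ ENNReal.ofReal ((2 : ℝ) ^ (-(n : ℤ)))

/-- The ideal points of level `n + 2`: both coordinates are integer multiples of `2^{-n-2}`. -/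
def idealPoints (n : ℕ) : Set ℂ :=
  {z | ∃ i j : ℤ, z = ⟨(i : ℝ) / 2 ^ (n + 2), (j : ℝ) / 2 ^ (n + 2)⟩}

/-- `h` is a valid choice of the function `h_C(n, ·)` on the ideal points of level `n + 2`. -/
def IsValidAt (C : Set ℂ) (n : ℕ) (h : ℂ → Fin 2) : Prop :=
  ∀ z ∈ idealPoints n,
    (supInfDist z C < (2 : ℝ) ^ (-(n : ℤ) - 2) → h z = 1) ∧
    ((2 : ℝ) ^ (-(n : ℤ) - 1) ≤ supInfDist z C → h z = 0)

/-- The `L^∞`-picture drawn according to `h` at level `n`: the union of the square pixels of radius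
`2^{-n-3}` centred at the ideal points where `h` is `1`. -/
def picture (n : ℕ) (h : ℂ → Fin 2) : Set ℂ :=
  ⋃ z ∈ {z | z ∈ idealPoints n ∧ h z = 1}, closedBox z ((2 : ℝ) ^ (-(n : ℤ) - 3))

/-! ### Polynomial dynamics -/

/-- The polynomial map `z ↦ p(z)`. -/
def pmap (p : ℂ[X]) (z : ℂ) : ℂ := p.eval z

/-- The filled Julia set: the points with bounded orbit. -/
def filledJulia (p : ℂ[X]) : Set ℂ :=
  {z | Bornology.IsBounded (Set.range fun n : ℕ => (pmap p)^[n] z)}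

/-- The Julia set: the topological boundary of the filled Julia set. -/
def julia (p : ℂ[X]) : Set ℂ := frontier (filledJulia p)

/-- `p` is hyperbolic: it is uniformly expanding on its Julia set. The constant `c` absorbs the
passage from any Riemannian metric that is uniformly equivalent to the Euclidean one. -/
def IsHyperbolic (p : ℂ[X]) : Prop :=
  ∃ c > (0 : ℝ), ∃ L > (1 : ℝ), ∀ z ∈ julia p, ∀ n : ℕ, c * L ^ n ≤ ‖deriv ((pmap p)^[n]) z‖

/-! ### The output of the precomputation -/

/-- The data computed in Step 1(a). -/
structure StepOneA where
  /-- The number of iterates. -/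
  ν : ℕ
  /-- The size of the collar. -/
  δ : ℝ
  /-- The expansion excess. -/
  lam : ℝ
  /-- Centres and radii of a finite collection of closed boxes covering the Julia set. -/
  boxes : Finset (ℂ × ℝ)
  /-- The large box `[-R, R]^2` contains the Julia set. -/
  R : ℝ

/-- The union of the boxes of the first collection. -/
def StepOneA.cover (A : StepOneA) : Set ℂ := ⋃ b ∈ A.boxes, closedBox b.1 b.2

/-- `𝒩₁`: the union of the boxes, with radii increased by `2 δ`. -/
def StepOneA.N1 (A : StepOneA) : Set ℂ := nbhd A.cover (2 * A.δ)

/-- The expansion constant `L = 1 + λ' / 2` on `𝒩₁`. -/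
def StepOneA.L (A : StepOneA) : ℝ := 1 + A.lam / 2

/-- The iterate `g = p^ν`. -/
def StepOneA.g (p : ℂ[X]) (A : StepOneA) : ℂ → ℂ := (pmap p)^[A.ν]

/-- `A` is an admissible output of Step 1(a) for `p`. -/
structure IsStepOneA (p : ℂ[X]) (A : StepOneA) : Prop where
  ν_pos : 0 < A.ν
  δ_pos : 0 < A.δ
  δ_dyadic : IsDyadic A.δ
  lam_pos : 0 < A.lam
  lam_dyadic : IsDyadic A.lam
  radius_pos : ∀ b ∈ A.boxes, 0 < b.2
  disjoint_interiors : ∀ b ∈ A.boxes, ∀ b' ∈ A.boxes, b ≠ b' →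
    Disjoint (openBox b.1 b.2) (openBox b'.1 b'.2)
  julia_subset : julia p ⊆ A.cover
  expanding : ∀ z ∈ A.cover, 1 + A.lam < ‖deriv (A.g p) z‖
  /-- `2 δ` is a modulus of continuity of `Dg` at the points of the boxes, for the tolerance
  `λ' / 2`; this is how `δ` is computed. -/
  modulus : ∀ z ∈ A.cover, ∀ w, supDist w z < 2 * A.δ →
    ‖deriv (A.g p) w - deriv (A.g p) z‖ ≤ A.lam / 2
  expanding_N1 : ∀ z ∈ A.N1, A.L < ‖deriv (A.g p) z‖
  R_pow : ∃ m : ℕ, A.R = 2 ^ m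
  julia_subset_R : julia p ⊆ closedBox 0 A.R

/-- `γ_r(a)`. -/
def gammaR (r a : ℝ) : ℝ :=
  max (1 - 1 / (1 + a / r) ^ 2) (1 / (1 - a / r) ^ 2 - 1)

/-- `c(γ)`. -/
def cGamma (γ : ℝ) : ℝ := (1 - 3 * γ) * (1 - γ) / (1 + γ)

/-- The data chosen or computed in Steps 1(b) and 1(c). -/
structure StepOneB where
  γ : ℝ
  a : ℝ
  /-- The side-length `β'` of the reference boxes. -/
  β : ℝ
  /-- The centres of the reference boxes. -/
  centers : Finset ℂ
  /-- The threshold `N'` for the precision. -/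
  Nmin : ℕ

/-- The reference box of side-length `β'` with centre `q`. -/
def StepOneB.refBox (B : StepOneB) (q : ℂ) : Set ℂ := closedBox q (B.β / 2)

/-- `𝒩₂`: the union of the reference boxes. -/
def StepOneB.N2 (B : StepOneB) : Set ℂ := ⋃ q ∈ B.centers, B.refBox q

/-- The upper bound `b` for the side-length of the reference boxes. -/
def StepOneB.b (A : StepOneA) (B : StepOneB) : ℝ :=
  min (A.δ * cGamma B.γ / (16 * √2 * (1 + B.γ))) B.a

/-- `B` is an admissible outcome of Steps 1(b) and 1(c), after Step 1(a) has returned `A`. -/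
structure IsStepOneB (p : ℂ[X]) (A : StepOneA) (B : StepOneB) : Prop where
  γ_pos : 0 < B.γ
  γ_le : B.γ ≤ 1 / 10
  a_pos : 0 < B.a
  a_lt : B.a < 3 * A.δ / 4
  gamma_eq : gammaR (3 * A.δ / 4) B.a = B.γ
  β_pos : 0 < B.β
  β_lt : B.β < B.b A
  julia_subset : julia p ⊆ B.N2
  meets_julia : ∀ q ∈ B.centers, (B.refBox q ∩ julia p).Nonempty
  expanding : ∀ z ∈ B.N2, A.L < ‖deriv (A.g p) z‖
  collar : nbhd B.N2 A.δ ⊆ A.N1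
  Nmin_a : (2 : ℝ) ^ (-(B.Nmin : ℤ) - 1) < B.a
  Nmin_δ : (2 : ℝ) ^ (-(B.Nmin : ℤ)) < A.δ

/-! ### The algorithm at an ideal point -/

/-- `σ_N = 2^{-N-3}`. -/
def sigma (N : ℕ) : ℝ := (2 : ℝ) ^ (-(N : ℤ) - 3)

/-- Step 2(a): the maximal number `k_N` of iterates. -/
def kMax (A : StepOneA) (B : StepOneB) (N : ℕ) : ℕ :=
  ⌈1 / Real.logb 2 A.L * (N + 3 + Real.logb 2 (2 * B.β * √2 / cGamma B.γ))⌉₊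

open scoped Classical in
/-- Steps 2(b)-(e) for one value of `k`: the reported value, or `none` if no test applies. -/
def stepTwoTest (p : ℂ[X]) (A : StepOneA) (B : StepOneB) (N : ℕ) (z : ℂ) (k : ℕ) :
    Option (Fin 2) :=
  let zk : ℂ := (A.g p)^[k] z
  let D : ℝ := ‖deriv ((A.g p)^[k]) z‖
  if Disjoint (Metric.ball zk (D * (3 * sigma N) * (1 + B.γ))) B.N2 then some 0
  else if ∃ q ∈ B.centers, B.refBox q ⊆ Metric.ball zk (D * (4 * sigma N) * (1 - B.γ)) then some 1
  else if 2 * B.β * √2 < D * sigma N * cGamma B.γ then some 0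
  else none

/-- Step 2: the tests are run for `k = 1, …, k_N` in turn, and the first value found is reported;
if there is none, then `0` is reported (Step 2(f)). -/
def stepTwo (p : ℂ[X]) (A : StepOneA) (B : StepOneB) (N : ℕ) (z : ℂ) : Fin 2 :=
  ((List.range (kMax A B N)).findSome? fun i => stepTwoTest p A B N z (i + 1)).getD 0

open scoped Classical in
/-- The value reported by the algorithm at precision `N` for the ideal point `z`: the base cases
of Step 1(c)-(f), and then Step 2. -/
def report (p : ℂ[X]) (A : StepOneA) (B : StepOneB) (N : ℕ) (z : ℂ) : Fin 2 :=
  if z ∉ closedBox 0 (A.R + 1) then 0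
  else if B.N2 ∩ closedBox z ((2 : ℝ) ^ (-(N : ℤ) - 2)) = ∅ then 0
  else if ∃ q ∈ B.centers, B.refBox q ⊆ openBox z ((2 : ℝ) ^ (-(N : ℤ) - 1)) then 1
  else if B.β * √2 < (2 : ℝ) ^ (-(N : ℤ) - 2) then 0
  else stepTwo p A B N z

/-- The picture that the algorithm draws for precision `N`; for `N < N'` it is the one for `N'`. -/
def drawnPicture (p : ℂ[X]) (A : StepOneA) (B : StepOneB) (N : ℕ) : Set ℂ :=
  picture (max N B.Nmin) (report p A B (max N B.Nmin))

end HypJulia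

end

namespace HypJulia

/-! ### The `L^∞` distance -/

/-! Write `σ` for `sigma N` and `D` for the modulus of the derivative of the current iterate `g^k`
at `z`. Both questions at an ideal point (is `J` within `2σ`, is it within `4σ`?) are transported
forward by `g^k`, which is nearly a similarity of ratio `D` around `z`, and are answered at the
scale of the reference boxes, each of which meets `J`. Complete invariance of `J` carries the
answers back.

The proof is an induction on the stage with invariant `IsNearStage`. If the test for reporting `0`
fails, a reference box meets the ball of radius `3σD(1+γ)`, so the orbit is close to `J`. If the
test for reporting `1` fails too, that box leaves the ball of radius `4σD(1-γ)`, so `σD(1-7γ)` is at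
most the bound `√2 β` on its diameter. Hence the orbit stays where `g` expands and the image of the
pixel stays small, which gives distortion control one stage further (`distortion_of_isNearStage`)
and makes the next test correct (`stepTwoTest_spec`). The invariant also excludes the size tests
that report `0`. Since `D` exceeds `L^k`, it cannot survive `k_N` stages, so the default value is
never used.

The distortion bound is elementary: the Schwarz lemma applied to `g'` gives a quadratic Taylor
error, and along an expanding orbit the accumulated relative errors are governed by the last scale
alone (`distortion_step`). Neither injectivity nor a Koebe theorem is needed;
`ball_subset_image_ball` supplies preimages by openness and connectedness. -/

theorem supDist_comm (z w : ℂ) : supDist z w = supDist w z := by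
  rw [supDist_eq, supDist_eq, dist_comm]

theorem supDist_triangle (x y z : ℂ) : supDist x z ≤ supDist x y + supDist y z := by
  simpa only [supDist_eq] using dist_triangle (toPlane x) (toPlane y) (toPlane z)

theorem supDist_le_norm (z w : ℂ) : supDist z w ≤ ‖z - w‖ :=
  max_le (Complex.abs_re_le_norm (z - w)) (Complex.abs_im_le_norm (z - w))

theorem norm_le_supDist (z w : ℂ) : ‖z - w‖ ≤ √2 * supDist z w :=
  Complex.norm_le_sqrt_two_mul_max (z - w)

theorem supInfDist_lt_iff {C : Set ℂ} (hC : C.Nonempty) {z : ℂ} {r : ℝ} :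
    supInfDist z C < r ↔ ∃ w ∈ C, supDist z w < r := by
  rw [supInfDist, Metric.infDist_lt_iff (hC.image _)]
  simp [supDist_eq]

/-- Two points of a box of side-length `β` are at Euclidean distance at most `√2 β`. -/
theorem norm_sub_le_of_mem_closedBox {q x y : ℂ} {β : ℝ} (hx : x ∈ closedBox q (β / 2))
    (hy : y ∈ closedBox q (β / 2)) : ‖x - y‖ ≤ √2 * β := by
  refine (norm_le_supDist x y).trans (mul_le_mul_of_nonneg_left ?_ (Real.sqrt_nonneg 2))
  have h := supDist_triangle x q y
  rw [supDist_comm q y] at h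
  simp only [closedBox, Set.mem_ofPred_eq] at hx hy
  linarith

theorem supDist_le_of_mem_closedBox {q x y : ℂ} {β : ℝ} (hx : x ∈ closedBox q (β / 2))
    (hy : y ∈ closedBox q (β / 2)) : supDist x y ≤ β := by
  have h := supDist_triangle x q y
  rw [supDist_comm q y] at h
  simp only [closedBox, Set.mem_ofPred_eq] at hx hy
  linarith

/-! ### Grids of boxes -/

/-- The point of the grid of mesh `s` with coordinates `(i, j)`. -/
def gridPoint (s : ℝ) (i : ℤ × ℤ) : ℂ := ⟨i.1 * s, i.2 * s⟩

theorem exists_gridPoint_supDist_le {s : ℝ} (hs : 0 < s) (z : ℂ) :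
    ∃ i, supDist z (gridPoint s i) ≤ s / 2 := by
  have key : ∀ x : ℝ, |x - round (x / s) * s| ≤ s / 2 := fun x => by
    have h := mul_le_mul_of_nonneg_right (abs_sub_round (x / s)) hs.le
    rw [← abs_of_pos hs, ← abs_mul, abs_of_pos hs, sub_mul, div_mul_cancel₀ _ hs.ne'] at h
    linarith
  exact ⟨(round (z.re / s), round (z.im / s)), max_le (key _) (key _)⟩

theorem le_supDist_gridPoint {s : ℝ} (hs : 0 < s) {i j : ℤ × ℤ} (hij : i ≠ j) :
    s ≤ supDist (gridPoint s i) (gridPoint s j) := by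
  have key : ∀ a b : ℤ, a ≠ b → s ≤ |(a : ℝ) * s - b * s| := fun a b hab => by
    rw [← sub_mul, abs_mul, abs_of_pos hs]
    have : (1 : ℝ) ≤ |(a : ℝ) - b| := by
      exact_mod_cast Int.one_le_abs (sub_ne_zero.mpr hab)
    nlinarith
  by_cases h : i.1 = j.1
  · exact (key _ _ fun h' => hij (Prod.ext h h')).trans (le_max_right _ _)
  · exact (key _ _ h).trans (le_max_left _ _)

/-- A bounded set is covered by finitely many boxes of a grid, all meeting the set. -/
theorem exists_finset_grid {C : Set ℂ} {R s : ℝ} (hs : 0 < s) (hC : ∀ z ∈ C, ‖z‖ ≤ R) :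
    ∃ I : Finset (ℤ × ℤ), (∀ i ∈ I, (closedBox (gridPoint s i) (s / 2) ∩ C).Nonempty) ∧
      ∀ z ∈ C, ∃ i ∈ I, z ∈ closedBox (gridPoint s i) (s / 2) := by
  have hfin : {i : ℤ × ℤ | (closedBox (gridPoint s i) (s / 2) ∩ C).Nonempty}.Finite := by
    set M : ℤ := ⌈(R + s / 2) / s⌉
    refine ((Set.finite_Icc (-M) M).prod (Set.finite_Icc (-M) M)).subset ?_
    rintro i ⟨z, hz, hzC⟩
    have key : ∀ (x : ℝ) (k : ℤ), |x| ≤ R → |x - k * s| ≤ s / 2 → k ∈ Set.Icc (-M) M := by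
      intro x k hx hk
      have hM : (R + s / 2) / s ≤ M := Int.le_ceil _
      rw [div_le_iff₀ hs] at hM
      rw [abs_le] at hx hk
      constructor
      · have : -(M : ℝ) ≤ k := by
          by_contra! h
          nlinarith
        exact_mod_cast this
      · have : (k : ℝ) ≤ M := by
          by_contra! h
          nlinarith
        exact_mod_cast this
    have hz' := max_le_iff.mp (show max _ _ ≤ s / 2 from hz)
    exact ⟨key z.re _ ((Complex.abs_re_le_norm z).trans (hC z hzC)) hz'.1,
      key z.im _ ((Complex.abs_im_le_norm z).trans (hC z hzC)) hz'.2⟩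
  refine ⟨hfin.toFinset, fun i hi => by simpa using hi, fun z hz => ?_⟩
  obtain ⟨i, hi⟩ := exists_gridPoint_supDist_le hs z
  exact ⟨i, by simpa using ⟨z, hi, hz⟩, hi⟩

/-! ### The Julia set of a polynomial -/

/-- Write `p = qX + p(0)` with `q` nonconstant: far out, `|q| ≥ 3` and `|p(0)| ≤ |z|`. -/
theorem exists_two_mul_norm_le {p : ℂ[X]} (hdeg : 2 ≤ p.natDegree) :
    ∃ R > (0 : ℝ), ∀ z : ℂ, R ≤ ‖z‖ → 2 * ‖z‖ ≤ ‖pmap p z‖ := by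
  have hq : 0 < p.divX.degree := by
    rw [← natDegree_pos_iff_degree_pos, natDegree_divX_eq_natDegree_tsub_one]
    omega
  have ht := p.divX.tendsto_norm_atTop hq (tendsto_norm_cobounded_atTop (E := ℂ))
  obtain ⟨r, -, hr⟩ := (Filter.hasBasis_cobounded_norm (E := ℂ)).eventually_iff.mp
    (ht.eventually_ge_atTop 3)
  refine ⟨max (max r ‖p.coeff 0‖) 1, by positivity, fun z hz => ?_⟩
  have h1 : 3 ≤ ‖p.divX.eval z‖ := hr ((le_max_left _ _).trans ((le_max_left _ _).trans hz))
  have h2 : ‖p.coeff 0‖ ≤ ‖z‖ := (le_max_right _ _).trans ((le_max_left _ _).trans hz)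
  have h3 : pmap p z = p.divX.eval z * z - -p.coeff 0 := by
    conv_lhs => rw [pmap, ← divX_mul_X_add p]
    simp
  have h4 := norm_sub_norm_le (p.divX.eval z * z) (-p.coeff 0)
  rw [← h3, norm_neg, norm_mul] at h4
  nlinarith [norm_nonneg z]

theorem exists_norm_lt_of_mem_filledJulia {p : ℂ[X]} (hdeg : 2 ≤ p.natDegree) :
    ∃ R > (0 : ℝ), ∀ z ∈ filledJulia p, ‖z‖ < R := by
  obtain ⟨R, hR, h⟩ := exists_two_mul_norm_le hdeg
  refine ⟨R, hR, fun z hz => ?_⟩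
  by_contra! hz'
  have key : ∀ n : ℕ, 2 ^ n * R ≤ ‖(pmap p)^[n] z‖ := fun n => by
    induction n with
    | zero => simpa using hz'
    | succ n ih =>
      rw [Function.iterate_succ_apply']
      have h1 : 1 ≤ (2 : ℝ) ^ n := one_le_pow₀ one_le_two
      have := h ((pmap p)^[n] z) (by nlinarith)
      rw [pow_succ]
      linarith
  have hb : Bornology.IsBounded (Set.range fun n : ℕ => (pmap p)^[n] z) := hz
  obtain ⟨M, hM⟩ := hb.exists_norm_le
  obtain ⟨n, hn⟩ := pow_unbounded_of_one_lt (M / R) (one_lt_two (α := ℝ))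
  rw [div_lt_iff₀ hR] at hn
  exact absurd (hM _ ⟨n, rfl⟩) (not_le.mpr (hn.trans_le (key n)))

theorem exists_norm_le_of_mem_julia {p : ℂ[X]} (hdeg : 2 ≤ p.natDegree) :
    ∃ R > (0 : ℝ), ∀ z ∈ julia p, ‖z‖ ≤ R := by
  obtain ⟨R, hR, h⟩ := exists_norm_lt_of_mem_filledJulia hdeg
  refine ⟨R, hR, fun z hz => ?_⟩
  have : closure (filledJulia p) ⊆ Metric.closedBall 0 R :=
    closure_minimal (fun w hw => by simpa using (h w hw).le) Metric.isClosed_closedBall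
  simpa using this (frontier_subset_closure hz)

/-- A root of `p - X` has bounded orbit, points far out escape, and in the connected plane a
nonempty proper subset has a boundary point. -/
theorem julia_nonempty {p : ℂ[X]} (hdeg : 2 ≤ p.natDegree) : (julia p).Nonempty := by
  rw [julia, nonempty_frontier_iff]
  constructor
  · have hd : (p - X).natDegree = p.natDegree :=
      natDegree_sub_eq_left_of_natDegree_lt (by rw [natDegree_X]; omega)
    obtain ⟨z, hz⟩ := IsAlgClosed.exists_root (p - X)
      (degree_ne_of_natDegree_ne (n := 0) (by omega))
    have hfix : pmap p z = z := by
      simpa [pmap, IsRoot, sub_eq_zero] using hz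
    refine ⟨z, (Bornology.isBounded_singleton (x := z)).subset ?_⟩
    rintro _ ⟨n, rfl⟩
    exact Function.IsFixedPt.iterate hfix n
  · obtain ⟨R, hR, h⟩ := exists_norm_lt_of_mem_filledJulia hdeg
    intro huniv
    have := h (R : ℂ) (huniv ▸ Set.mem_univ _)
    simp [abs_of_pos hR] at this

theorem pmap_mem_filledJulia {p : ℂ[X]} {z : ℂ} :
    pmap p z ∈ filledJulia p ↔ z ∈ filledJulia p := by
  have : (Set.range fun n : ℕ => (pmap p)^[n] z) =
      {z} ∪ Set.range fun n : ℕ => (pmap p)^[n] (pmap p z) := by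
    ext w
    constructor
    · rintro ⟨_ | n, rfl⟩
      · exact Or.inl rfl
      · exact Or.inr ⟨n, rfl⟩
    · rintro (rfl | ⟨n, rfl⟩)
      · exact ⟨0, rfl⟩
      · exact ⟨n + 1, rfl⟩
  simp only [filledJulia, Set.mem_ofPred_eq]
  rw [this, Bornology.isBounded_union]
  simp

/-- Taking preimages under a continuous open map commutes with the frontier, and the filled Julia
set is its own preimage. -/
theorem pmap_mem_julia {p : ℂ[X]} (hdeg : 2 ≤ p.natDegree) {z : ℂ} :
    pmap p z ∈ julia p ↔ z ∈ julia p := by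
  have ho := p.isOpenQuotientMap_eval (by omega)
  have h := ho.isOpenMap.preimage_frontier_eq_frontier_preimage ho.continuous (filledJulia p)
  have h2 : (fun x => p.eval x) ⁻¹' filledJulia p = filledJulia p :=
    Set.ext fun w => pmap_mem_filledJulia
  rw [h2] at h
  exact Set.ext_iff.mp h z

theorem iterate_pmap_mem_julia {p : ℂ[X]} (hdeg : 2 ≤ p.natDegree) {z : ℂ} (n : ℕ) :
    (pmap p)^[n] z ∈ julia p ↔ z ∈ julia p := by
  induction n with
  | zero => rfl
  | succ n ih => rw [Function.iterate_succ_apply', pmap_mem_julia hdeg, ih]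

theorem g_iterate_mem_julia {p : ℂ[X]} (hdeg : 2 ≤ p.natDegree) (A : StepOneA) (k : ℕ) {z : ℂ} :
    (A.g p)^[k] z ∈ julia p ↔ z ∈ julia p := by
  rw [StepOneA.g, ← Function.iterate_mul, iterate_pmap_mem_julia hdeg]

theorem iterate_pmap_eq (p : ℂ[X]) (n : ℕ) : (pmap p)^[n] = fun z => (p.comp^[n] X).eval z :=
  funext fun z => by rw [iterate_comp_eval, eval_X]; rfl

theorem g_iterate_eq (p : ℂ[X]) (A : StepOneA) (k : ℕ) :
    (A.g p)^[k] = fun z => (p.comp^[A.ν * k] X).eval z := by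
  rw [StepOneA.g, ← Function.iterate_mul, iterate_pmap_eq]

theorem isOpenMap_g_iterate {p : ℂ[X]} (hdeg : 2 ≤ p.natDegree) (A : StepOneA) (k : ℕ) :
    IsOpenMap ((A.g p)^[k]) := by
  have h : ∀ n, IsOpenMap ((pmap p)^[n]) := fun n => by
    induction n with
    | zero => exact IsOpenMap.id
    | succ n ih =>
      rw [Function.iterate_succ']
      exact (p.isOpenQuotientMap_eval (by omega)).isOpenMap.comp ih
  rw [StepOneA.g, ← Function.iterate_mul]
  exact h _

theorem differentiable_g_iterate (p : ℂ[X]) (A : StepOneA) (k : ℕ) :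
    Differentiable ℂ ((A.g p)^[k]) := by
  rw [g_iterate_eq]
  exact Polynomial.differentiable _

theorem differentiable_g (p : ℂ[X]) (A : StepOneA) : Differentiable ℂ (A.g p) :=
  differentiable_g_iterate p A 1

theorem deriv_g_iterate_succ (p : ℂ[X]) (A : StepOneA) (k : ℕ) (z : ℂ) :
    ‖deriv ((A.g p)^[k + 1]) z‖ =
      ‖deriv ((A.g p)^[k]) z‖ * ‖deriv (A.g p) ((A.g p)^[k] z)‖ := by
  rw [Function.iterate_succ', deriv_comp z (differentiable_g p A _)
    (differentiable_g_iterate p A k z), norm_mul, mul_comm]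

/-! ### The choices of the precomputation exist -/

theorem exists_two_zpow_neg_lt {ε : ℝ} (hε : 0 < ε) : ∃ m : ℕ, (2 : ℝ) ^ (-(m : ℤ)) < ε := by
  obtain ⟨m, hm⟩ := exists_pow_lt_of_lt_one hε (one_half_lt_one (α := ℝ))
  exact ⟨m, by simpa [zpow_neg] using hm⟩

theorem exists_isStepOneA {p : ℂ[X]} (hdeg : 2 ≤ p.natDegree) (hp : IsHyperbolic p) :
    ∃ A, IsStepOneA p A := by
  obtain ⟨c, hc, L, hL, hexp⟩ := hp
  -- The number of iterates used is `ν + 1`, which is positive in any case. The bound `4` on `J`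
  -- leaves ample room for `λ' = 1` and variations of `1/2`.
  obtain ⟨ν, hν⟩ := pow_unbounded_of_one_lt (4 / c) hL
  rw [div_lt_iff₀ hc] at hν
  obtain ⟨R, hR, hJR⟩ := exists_norm_le_of_mem_julia hdeg
  obtain ⟨m, hm⟩ := pow_unbounded_of_one_lt R (one_lt_two (α := ℝ))
  set f : ℂ → ℂ := deriv ((pmap p)^[ν + 1]) with hf
  have hfc : Continuous f := by
    have : f = fun z => (derivative (p.comp^[ν + 1] X)).eval z := by
      rw [hf, iterate_pmap_eq]
      exact funext fun z => Polynomial.deriv _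
    rw [this]
    exact Polynomial.continuous _
  have hJ4 : ∀ z ∈ julia p, 4 < ‖f z‖ := fun z hz => by
    have h1 := hexp z hz (ν + 1)
    have h2 : 4 < c * L ^ (ν + 1) := by
      rw [pow_succ]
      nlinarith
    exact h2.trans_le h1
  obtain ⟨ε, hε, hcont⟩ := Metric.uniformContinuousOn_iff.mp
    ((isCompact_closedBall (0 : ℂ) (R + 4)).uniformContinuousOn_of_continuous hfc.continuousOn)
    (1 / 2) one_half_pos
  obtain ⟨l, hl⟩ := exists_two_zpow_neg_lt (show 0 < min (ε / 4) (1 / 2) by positivity)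
  set s : ℝ := (2 : ℝ) ^ (-(l : ℤ)) with hs
  have hs0 : 0 < s := by positivity
  have hsε : 4 * s < ε := by linarith [hl.trans_le (min_le_left _ _)]
  have hs1 : s < 1 / 2 := hl.trans_le (min_le_right _ _)
  have hsqrt : √2 < 2 := by
    rw [Real.sqrt_lt' two_pos]
    norm_num
  obtain ⟨I, hI, hcov⟩ := exists_finset_grid hs0 hJR
  have hinj : Function.Injective fun i : ℤ × ℤ => (gridPoint s i, s / 2) := fun i j hij => by
    by_contra hne
    have h1 := le_supDist_gridPoint hs0 hne
    rw [(Prod.mk.inj hij).1] at h1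
    simp [supDist] at h1
    linarith
  -- The mesh `s` serves as both the side-length of the boxes and `δ`. Since `√2 < 2` and `4s < ε`,
  -- uniform continuity covers both the passage from `J` to the boxes and the one to their
  -- `2δ`-collar.
  set A : StepOneA := ⟨ν + 1, s, 1, I.map ⟨_, hinj⟩, 2 ^ m⟩ with hA
  have hAg : deriv (A.g p) = f := rfl
  have hcover : ∀ z, z ∈ A.cover ↔ ∃ i ∈ I, z ∈ closedBox (gridPoint s i) (s / 2) := fun z => by
    simp [StepOneA.cover, hA]
  have hnear : ∀ z ∈ A.cover, ‖z‖ ≤ R + 1 ∧ 4 - 1 / 2 < ‖f z‖ := fun z hz => by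
    obtain ⟨i, hi, hzi⟩ := (hcover z).mp hz
    obtain ⟨y, hyi, hyJ⟩ := hI i hi
    have h1 : ‖z - y‖ ≤ √2 * s := norm_sub_le_of_mem_closedBox hzi hyi
    have h2 : ‖z - y‖ < 2 * s := by nlinarith
    have h3 := norm_sub_norm_le z y
    have h4 := hJR y hyJ
    have hz' : ‖z‖ ≤ R + 1 := by linarith
    have h5 := hcont y (by rw [mem_closedBall_zero_iff]; linarith) z
      (by rw [mem_closedBall_zero_iff]; linarith) (by rw [dist_comm, dist_eq_norm]; linarith)
    rw [dist_eq_norm] at h5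
    have h6 := norm_sub_norm_le (f y) (f z)
    exact ⟨hz', by linarith [hJ4 y hyJ]⟩
  have hmod : ∀ z ∈ A.cover, ∀ w, supDist w z < 2 * A.δ →
      ‖deriv (A.g p) w - deriv (A.g p) z‖ ≤ A.lam / 2 := fun z hz w hw => by
    have h1 := norm_le_supDist w z
    have h2 : ‖w - z‖ < 4 * s := by
      have : supDist w z < 2 * s := hw
      have h0 : 0 ≤ supDist w z := (abs_nonneg _).trans (le_max_left _ _)
      nlinarith
    have h3 := norm_sub_norm_le w z
    have h4 := (hnear z hz).1
    have h5 := hcont w (by rw [mem_closedBall_zero_iff]; linarith) z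
      (by rw [mem_closedBall_zero_iff]; linarith) (by rw [dist_eq_norm]; linarith)
    rw [dist_eq_norm] at h5
    exact h5.le
  refine ⟨A, ⟨Nat.succ_pos _, hs0, ⟨1, l, by simp [hA, hs, zpow_neg]⟩, one_pos,
    ⟨1, 0, by simp [hA]⟩, ?_, ?_, ?_, ?_, hmod, ?_, ⟨m, rfl⟩, ?_⟩⟩
  · intro b hb
    obtain ⟨i, -, rfl⟩ := Finset.mem_map.mp hb
    exact half_pos hs0
  · intro b hb b' hb' hne
    obtain ⟨i, -, rfl⟩ := Finset.mem_map.mp hb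
    obtain ⟨j, -, rfl⟩ := Finset.mem_map.mp hb'
    have hij : i ≠ j := fun h => hne (by rw [h])
    refine Set.disjoint_left.mpr fun z hz hz' => ?_
    have h1 : supDist z (gridPoint s i) < s / 2 := hz
    have h2 : supDist z (gridPoint s j) < s / 2 := hz'
    have h3 := supDist_triangle (gridPoint s i) z (gridPoint s j)
    rw [supDist_comm _ z] at h3
    linarith [le_supDist_gridPoint hs0 hij]
  · exact fun z hz => (hcover z).mpr (hcov z hz)
  · intro z hz
    have h1 := (hnear z hz).2
    rw [hAg]
    change 1 + 1 < ‖f z‖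
    linarith
  · rintro w ⟨z, hz, hw⟩
    have h1 := hmod z hz w hw
    have h2 := (hnear z hz).2
    have h3 := norm_sub_norm_le (deriv (A.g p) z) (deriv (A.g p) w)
    rw [norm_sub_rev] at h3
    rw [hAg] at h1 h3 ⊢
    change _ ≤ (1 : ℝ) / 2 at h1
    change 1 + (1 : ℝ) / 2 < _
    linarith
  · intro z hz
    have h1 := supDist_le_norm z 0
    rw [sub_zero] at h1
    exact h1.trans ((hJR z hz).trans hm.le)

/-- The second entry of the maximum dominates, so one solves `(1 - a/r)^{-2} = 1 + γ` explicitly. -/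
theorem exists_gammaR_eq {r γ : ℝ} (hr : 0 < r) (hγ : 0 < γ) :
    ∃ a, 0 < a ∧ a < r ∧ gammaR r a = γ := by
  have hs : 1 < √(1 + γ) := by
    rw [Real.lt_sqrt zero_le_one]
    linarith
  set x : ℝ := 1 - 1 / √(1 + γ) with hx
  have hx0 : 0 < x := by
    rw [hx, sub_pos, div_lt_one (by linarith)]
    exact hs
  have hx1 : x < 1 := by
    have : 0 < 1 / √(1 + γ) := by positivity
    linarith
  refine ⟨r * x, by positivity, by nlinarith, ?_⟩
  have h1 : r * x / r = x := by field_simp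
  have h2 : 1 / (1 - x) ^ 2 = 1 + γ := by
    rw [hx, sub_sub_cancel, div_pow, Real.sq_sqrt (by linarith), one_pow, one_div_one_div]
  rw [gammaR, h1, h2, max_eq_right, add_sub_cancel_left]
  have h4 : (1 - x) ^ 2 * (1 + γ) = 1 := by
    rw [← h2]
    have : 1 - x ≠ 0 := by linarith
    field_simp
  have h3 : 1 - γ ≤ 1 / (1 + x) ^ 2 := by
    rw [le_div_iff₀ (by positivity)]
    have h5 : ((1 + x) * (1 - x)) ^ 2 ≤ 1 := pow_le_one₀ (by nlinarith) (by nlinarith)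
    have h6 : (1 + x) ^ 2 ≤ 1 + γ := by
      have : (1 + x) ^ 2 = ((1 + x) * (1 - x)) ^ 2 * (1 + γ) := by
        linear_combination (-(1 + x) ^ 2) * h4
      nlinarith
    rcases le_total γ 1 with h | h
    · nlinarith
    · nlinarith [sq_nonneg (1 + x)]
  linarith

theorem exists_isStepOneB {p : ℂ[X]} (hdeg : 2 ≤ p.natDegree) {A : StepOneA}
    (hA : IsStepOneA p A) {γ : ℝ} (hγ : 0 < γ) (hγ' : γ ≤ 1 / 10) :
    ∃ B, B.γ = γ ∧ IsStepOneB p A B := by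
  obtain ⟨R, hR, hJR⟩ := exists_norm_le_of_mem_julia hdeg
  have hδ := hA.δ_pos
  obtain ⟨a, ha, ha', haγ⟩ := exists_gammaR_eq (show 0 < 3 * A.δ / 4 by linarith) hγ
  have hc : 0 < cGamma γ :=
    div_pos (mul_pos (by linarith) (by linarith)) (by linarith)
  obtain ⟨l, hl⟩ := exists_two_zpow_neg_lt (show 0 < min (min
    (A.δ * cGamma γ / (16 * √2 * (1 + γ))) a) A.δ by positivity)
  obtain ⟨n, hn⟩ := exists_two_zpow_neg_lt (show 0 < min a A.δ by positivity)
  set s : ℝ := (2 : ℝ) ^ (-(l : ℤ)) with hs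
  have hs0 : 0 < s := by positivity
  obtain ⟨I, hI, hcov⟩ := exists_finset_grid hs0 hJR
  classical
  set B : StepOneB := ⟨γ, a, s, I.image (gridPoint s), n⟩ with hB
  have hN2 : ∀ z, z ∈ B.N2 ↔ ∃ i ∈ I, z ∈ closedBox (gridPoint s i) (s / 2) := fun z => by
    simp [StepOneB.N2, StepOneB.refBox, hB]
  have hJ : ∀ z ∈ B.N2, ∃ y ∈ julia p, supDist z y < A.δ := fun z hz => by
    obtain ⟨i, hi, hzi⟩ := (hN2 z).mp hz
    obtain ⟨y, hyi, hyJ⟩ := hI i hi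
    exact ⟨y, hyJ, (supDist_le_of_mem_closedBox hzi hyi).trans_lt (hl.trans_le (min_le_right _ _))⟩
  have hcollar : nbhd B.N2 A.δ ⊆ A.N1 := by
    rintro w ⟨z, hz, hwz⟩
    obtain ⟨y, hy, hzy⟩ := hJ z hz
    refine ⟨y, hA.julia_subset hy, (supDist_triangle w z y).trans_lt ?_⟩
    linarith
  refine ⟨B, rfl, ⟨hγ, hγ', ha, ha', haγ, hs0, hl.trans_le (min_le_left _ _), ?_, ?_, ?_,
    hcollar, ?_, hn.trans_le (min_le_right _ _)⟩⟩
  · exact fun z hz => (hN2 z).mpr (hcov z hz)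
  · intro q hq
    obtain ⟨i, hi, rfl⟩ := Finset.mem_image.mp hq
    exact hI i hi
  · intro z hz
    exact hA.expanding_N1 z (hcollar ⟨z, hz, by simpa [supDist] using hδ⟩)
  · refine lt_of_le_of_lt ?_ (hn.trans_le (min_le_left _ _))
    exact zpow_le_zpow_right₀ one_le_two (by simp [hB])

/-! ### Distortion -/

/-- A first-order Taylor estimate: if the derivative varies at most linearly then the remainder is
at most quadratic, with half the constant. -/
theorem norm_sub_sub_deriv_mul_le {f : ℂ → ℂ} (hf : Differentiable ℂ f) {z : ℂ} {r K : ℝ}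
    (hK : ∀ w, ‖w - z‖ < r → ‖deriv f w - deriv f z‖ ≤ K * ‖w - z‖) {w : ℂ} (hw : ‖w - z‖ < r) :
    ‖f w - f z - deriv f z * (w - z)‖ ≤ K / 2 * ‖w - z‖ ^ 2 := by
  set F : ℝ → ℂ := fun t => f (z + t * (w - z)) - f z - t * (deriv f z * (w - z)) with hF
  set F' : ℝ → ℂ := fun t => (deriv f (z + t * (w - z)) - deriv f z) * (w - z) with hF'
  have hder : ∀ t : ℝ, HasDerivAt F (F' t) t := fun t => by
    have h1 : HasDerivAt (fun t : ℝ => (t : ℂ)) 1 t := Complex.ofRealCLM.hasDerivAt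
    have h2 : HasDerivAt (fun t : ℝ => z + t * (w - z)) (w - z) t := by
      simpa using (h1.mul_const (w - z)).const_add z
    have h3 := (hf (z + t * (w - z))).hasDerivAt.comp t h2
    have h4 := (h3.sub_const (f z)).sub (h1.mul_const (deriv f z * (w - z)))
    exact h4.congr_deriv (by simp only [hF']; ring)
  have hB : ∀ t : ℝ, HasDerivAt (fun t : ℝ => K / 2 * ‖w - z‖ ^ 2 * t ^ 2)
      (K * ‖w - z‖ ^ 2 * t) t := fun t => by
    exact ((hasDerivAt_pow 2 t).const_mul (K / 2 * ‖w - z‖ ^ 2)).congr_deriv (by push_cast; ring)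
  have h := image_norm_le_of_norm_deriv_right_le_deriv_boundary (a := 0) (b := 1)
    (fun t _ => (hder t).continuousAt.continuousWithinAt)
    (fun t _ => (hder t).hasDerivWithinAt) (by simp [hF]) hB ?_ (Set.right_mem_Icc.mpr zero_le_one)
  · simpa [hF] using h
  · intro t ht
    have h1 : ‖z + t * (w - z) - z‖ = t * ‖w - z‖ := by
      rw [add_sub_cancel_left, norm_mul, Complex.norm_real, Real.norm_of_nonneg ht.1]
    have h2 := hK (z + t * (w - z)) (by rw [h1]; nlinarith [norm_nonneg (w - z), ht.2])
    rw [h1] at h2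
    rw [hF', norm_mul]
    nlinarith [norm_nonneg (w - z)]

/-- Near a point `ζ` at which `f'` has modulus at least `1 + λ` and around which `f'` varies by at
most `λ / 2` up to distance `2 δ`, the map `f` is expanding, with a small quadratic error. -/
theorem expansion_of_deriv_modulus {f : ℂ → ℂ} (hf : Differentiable ℂ f) {ζ z : ℂ} {δ lam : ℝ}
    (hδ : 0 < δ) (hlam : 0 < lam)
    (hmod : ∀ w, ‖w - ζ‖ < 2 * δ → ‖deriv f w - deriv f ζ‖ ≤ lam / 2)
    (hexp : 1 + lam < ‖deriv f ζ‖) (hz : ‖z - ζ‖ ≤ 2 * δ / 5) :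
    1 + 9 / 10 * lam ≤ ‖deriv f z‖ ∧ ∀ w, ‖w - z‖ < 8 * δ / 5 →
      ‖f w - f z - deriv f z * (w - z)‖ ≤ 9 / 10 * lam * (5 / (24 * δ)) * ‖w - z‖ ^ 2 := by
  have hd : Differentiable ℂ (deriv f) := fun w =>
    (hf.analyticAt w).deriv.differentiableAt
  -- The Schwarz lemma for `f'` on the ball of radius `2δ` scales the tolerance `λ/2` by the factor
  -- `(2δ/5)/(2δ) = 1/5`.
  have hzζ : ‖deriv f z - deriv f ζ‖ ≤ lam / 10 := by
    have h := Complex.dist_le_div_mul_dist_of_mapsTo_ball (c := ζ) (z := z) (R₁ := 2 * δ)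
      (R₂ := lam / 2) hd.differentiableOn
      (fun w hw => by
        rw [Metric.mem_closedBall, dist_eq_norm]
        exact hmod w (by rwa [Metric.mem_ball, dist_eq_norm] at hw))
      (by rw [Metric.mem_ball, dist_eq_norm]; linarith)
    rw [dist_eq_norm, dist_eq_norm] at h
    refine h.trans ?_
    calc lam / 2 / (2 * δ) * ‖z - ζ‖ ≤ lam / 2 / (2 * δ) * (2 * δ / 5) := by gcongr
      _ = lam / 10 := by field_simp; norm_num
  constructor
  · have := norm_sub_norm_le (deriv f ζ) (deriv f z)
    rw [norm_sub_rev] at this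
    linarith
  · intro w hw
    -- Here `8δ/5 = 2δ - 2δ/5` and `3λ/5 = λ/2 + λ/10`. A second use of Schwarz makes the variation
    -- linear with constant `3λ/(8δ)`; half of it is `μC` with `μ = 9λ/10` and `C = 5/(24δ)`.
    have hmaps : Set.MapsTo (deriv f) (Metric.ball z (8 * δ / 5))
        (Metric.closedBall (deriv f z) (3 * lam / 5)) := fun y hy => by
      rw [Metric.mem_ball, dist_eq_norm] at hy
      rw [Metric.mem_closedBall, dist_eq_norm]
      have h1 : ‖y - ζ‖ < 2 * δ := by
        have := norm_sub_le_norm_sub_add_norm_sub y z ζ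
        linarith
      have h2 := norm_sub_le_norm_sub_add_norm_sub (deriv f y) (deriv f ζ) (deriv f z)
      rw [norm_sub_rev (deriv f ζ)] at h2
      linarith [hmod y h1]
    have h := norm_sub_sub_deriv_mul_le hf (z := z) (r := 8 * δ / 5)
      (K := 3 * lam / 5 / (8 * δ / 5)) (fun y hy => by
        have := Complex.dist_le_div_mul_dist_of_mapsTo_ball hd.differentiableOn hmaps
          (z := y) (by rwa [Metric.mem_ball, dist_eq_norm])
        rwa [dist_eq_norm, dist_eq_norm] at this) hw
    refine h.trans_eq ?_
    field_simp
    ring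

/-- The inductive step of the distortion estimate. -/
theorem distortion_step {T D G X X' ρ μ C : ℝ} (hC : 0 < C) (hμ : 0 < μ) (hρ : 0 ≤ ρ) (hD : 0 < D)
    (hG : 1 + μ ≤ G) (hT : 0 ≤ T) (hTD : T * (1 + μ) ≤ C * ρ * D) (hsmall : C * ρ * D < 1)
    (hX : 0 ≤ X) (hlow : (1 - T) * (D * ρ) ≤ X) (hup : X * (1 - T) ≤ D * ρ)
    (hX' : |X' - G * X| ≤ μ * C * X ^ 2) :
    (1 - C * ρ * D) * (D * G * ρ) ≤ X' ∧ X' * (1 - C * ρ * D) ≤ D * G * ρ := by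
  obtain ⟨y, hy⟩ : ∃ y, y = D * ρ := ⟨_, rfl⟩
  have hy0 : 0 ≤ y := hy ▸ mul_nonneg hD.le hρ
  have hTy : C * ρ * D = C * y := by rw [hy]; ring
  have hGy : D * G * ρ = G * y := by rw [hy]; ring
  rw [← hy] at hlow hup
  rw [hTy] at hTD hsmall ⊢
  rw [hGy]
  have hCy : 0 ≤ C * y := by positivity
  have hG0 : 0 < G := by linarith
  have hTle : T ≤ C * y := by nlinarith
  -- The new error `Cy` exceeds `T` by at least `Cy · μ/(1+μ)`; multiplied by `G ≥ 1 + μ`, this gain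
  -- pays for the quadratic remainder.
  have key : G * (1 - C * y) ≤ G * (1 - T) - μ * (C * y) := by nlinarith
  obtain ⟨h1, h2⟩ := abs_le.mp hX'
  constructor
  · have h3 : μ * C * (X * (1 - T)) ≤ μ * C * y := by gcongr
    have h4 : G * (1 - C * y) ≤ (1 - T) * (G - μ * C * X) := by linarith
    have h5 : 0 < (1 - T) * (G - μ * C * X) :=
      (mul_pos hG0 (by linarith)).trans_le h4
    have h6 : 0 < G - μ * C * X := pos_of_mul_pos_right h5 (by linarith)
    calc (1 - C * y) * (G * y) = G * (1 - C * y) * y := by ring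
      _ ≤ (1 - T) * (G - μ * C * X) * y := by gcongr
      _ = (1 - T) * y * (G - μ * C * X) := by ring
      _ ≤ X * (G - μ * C * X) := by gcongr
      _ ≤ X' := by linarith
  -- The relative Taylor error `e` enlarges `X'` by at most `1 + e`, while the gain in `key` yields
  -- a factor `1 - e`; the product is at most `1`.
  · set e : ℝ := μ * C * X / G with he
    have heG : e * G = μ * C * X := div_mul_cancel₀ _ hG0.ne'
    have he0 : 0 ≤ e := by positivity
    have h3 : 0 ≤ 1 - C * y := by linarith
    calc X' * (1 - C * y) ≤ (G * X + μ * C * X ^ 2) * (1 - C * y) := by gcongr; linarith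
      _ = X * (1 + e) * (G * (1 - C * y)) := by linear_combination (-(X * (1 - C * y))) * heG
      _ ≤ X * (1 + e) * (G * (1 - T) - μ * (C * y)) := by gcongr
      _ = (1 + e) * (G * (X * (1 - T)) - e * G * y) := by rw [heG]; ring
      _ ≤ (1 + e) * (G * y - e * G * y) := by gcongr
      _ = G * y * (1 - e ^ 2) := by ring
      _ ≤ G * y := mul_le_of_le_one_right (by positivity) (by nlinarith)

/-- Distortion of an iterate, along an orbit on which the map is expanding. -/
theorem exists_distortion_iterate {f : ℂ → ℂ} (hf : Differentiable ℂ f) {δ lam : ℝ} (hδ : 0 < δ)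
    (hlam : 0 < lam) {z w : ℂ} {k : ℕ}
    (hexp : ∀ j < k, 1 + 9 / 10 * lam ≤ ‖deriv f (f^[j] z)‖ ∧ ∀ y, ‖y - f^[j] z‖ < 8 * δ / 5 →
      ‖f y - f (f^[j] z) - deriv f (f^[j] z) * (y - f^[j] z)‖ ≤
        9 / 10 * lam * (5 / (24 * δ)) * ‖y - f^[j] z‖ ^ 2)
    (hsmall : ∀ j < k, 5 / (24 * δ) * ‖w - z‖ * ‖deriv (f^[j]) z‖ ≤ 1 / 10) :
    0 < ‖deriv (f^[k]) z‖ ∧ ∃ T, 0 ≤ T ∧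
      T * (1 + 9 / 10 * lam) ≤ 5 / (24 * δ) * ‖w - z‖ * ‖deriv (f^[k]) z‖ ∧
      (∀ j, k = j + 1 → T = 5 / (24 * δ) * ‖w - z‖ * ‖deriv (f^[j]) z‖) ∧
      (1 - T) * (‖deriv (f^[k]) z‖ * ‖w - z‖) ≤ ‖f^[k] w - f^[k] z‖ ∧
      ‖f^[k] w - f^[k] z‖ * (1 - T) ≤ ‖deriv (f^[k]) z‖ * ‖w - z‖ := by
  induction k with
  | zero =>
    refine ⟨by simp, 0, le_rfl, ?_, by simp, by simp, by simp⟩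
    rw [zero_mul]
    positivity
  | succ k ih =>
    obtain ⟨hD, T, hT, hTD, -, hlow, hup⟩ := ih (fun j hj => hexp j (hj.trans k.lt_succ_self))
      (fun j hj => hsmall j (hj.trans k.lt_succ_self))
    obtain ⟨hG, hquad⟩ := hexp k k.lt_succ_self
    have hs := hsmall k k.lt_succ_self
    have hchain : ‖deriv (f^[k + 1]) z‖ = ‖deriv (f^[k]) z‖ * ‖deriv f (f^[k] z)‖ := by
      rw [Function.iterate_succ', deriv_comp z (hf _) (hf.iterate k z), norm_mul, mul_comm]
    rw [hchain, Function.iterate_succ_apply', Function.iterate_succ_apply']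
    set D := ‖deriv (f^[k]) z‖
    set G := ‖deriv f (f^[k] z)‖ with hGdef
    set X := ‖f^[k] w - f^[k] z‖ with hXdef
    set ρ := ‖w - z‖
    have hC : 0 < 5 / (24 * δ) := by positivity
    have hCρD : 0 ≤ 5 / (24 * δ) * ρ * D := by positivity
    have hXsmall : X < 8 * δ / 5 := by
      have hT' : T ≤ 1 / 10 := by nlinarith
      have h1 : D * ρ ≤ 12 * δ / 25 := by
        have : 5 / (24 * δ) * ρ * D = 5 * (D * ρ) / (24 * δ) := by ring
        rw [this, div_le_iff₀ (by positivity)] at hs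
        linarith
      have hX0 : 0 ≤ X := norm_nonneg _
      nlinarith
    have hX' : |‖f (f^[k] w) - f (f^[k] z)‖ - G * X| ≤
        9 / 10 * lam * (5 / (24 * δ)) * X ^ 2 := by
      refine le_trans ?_ (hquad _ hXsmall)
      rw [hGdef, hXdef, ← norm_mul]
      exact abs_norm_sub_norm_le _ _
    have hstep := distortion_step hC (show 0 < 9 / 10 * lam by positivity) (norm_nonneg (w - z)) hD
      hG hT hTD (by linarith) (norm_nonneg _) hlow hup hX'
    -- The error after stage `k + 1` is measured by the derivative at stage `k`, so no smallness is
    -- needed at the new stage.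
    refine ⟨mul_pos hD (by linarith), 5 / (24 * δ) * ρ * D, hCρD, ?_, ?_, hstep.1, hstep.2⟩
    · rw [← mul_assoc]
      gcongr
    · intro j hj
      obtain rfl := Nat.succ_injective hj
      rfl

/-- An open map whose values on a sphere stay away from its value at the centre covers a ball. -/
theorem ball_subset_image_ball {f : ℂ → ℂ} (hf : Continuous f) (hfo : IsOpenMap f) {z : ℂ}
    {s m : ℝ} (hs : 0 < s) (hsphere : ∀ w, ‖w - z‖ = s → m ≤ ‖f w - f z‖) :
    Metric.ball (f z) m ⊆ f '' Metric.ball z s := by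
  rcases le_or_gt m 0 with hm | hm
  · simp [Metric.ball_eq_empty.mpr hm]
  -- The image of the sphere misses the target ball, so the image of the open ball and the
  -- complement of the image of the closed ball are disjoint open sets covering it; connectedness
  -- leaves only the first, which contains the centre.
  refine (Metric.isPreconnected_ball).subset_left_of_subset_union
    (v := (f '' Metric.closedBall z s)ᶜ) (hfo _ Metric.isOpen_ball)
    ((isCompact_closedBall z s).image hf).isClosed.isOpen_compl ?_ ?_ ?_
  · exact Set.disjoint_compl_right_iff_subset.mpr
      (Set.image_mono Metric.ball_subset_closedBall)
  · intro y hy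
    by_cases hyc : y ∈ f '' Metric.closedBall z s
    · obtain ⟨w, hw, rfl⟩ := hyc
      rw [Metric.mem_closedBall, dist_eq_norm] at hw
      rcases hw.lt_or_eq with h | h
      · exact Or.inl ⟨w, by rwa [Metric.mem_ball, dist_eq_norm], rfl⟩
      · rw [Metric.mem_ball, dist_eq_norm] at hy
        exact absurd hy (not_lt.mpr (hsphere w h))
    · exact Or.inr hyc
  · exact ⟨f z, Metric.mem_ball_self hm, z, Metric.mem_ball_self hs, rfl⟩

/-! ### The constants -/

theorem cGamma_pos {γ : ℝ} (hγ : 0 < γ) (hγ' : γ ≤ 1 / 10) : 0 < cGamma γ :=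
  div_pos (mul_pos (by linarith) (by linarith)) (by linarith)

theorem cGamma_le_one {γ : ℝ} (hγ : 0 < γ) (hγ' : γ ≤ 1 / 10) : cGamma γ ≤ 1 := by
  rw [cGamma, div_le_one (by linarith)]
  nlinarith

theorem cGamma_le {γ : ℝ} (hγ : 0 < γ) (hγ' : γ ≤ 1 / 10) : cGamma γ ≤ 2 * (1 - 7 * γ) := by
  rw [cGamma, div_le_iff₀ (by linarith)]
  nlinarith

/-- If `a/r` exceeded `γ/2`, then `(1+γ)(1-a/r)²` would be at most `(1+γ)(1-γ/2)² = 1 - 3γ²/4 + γ³/4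
< 1`. -/
theorem le_of_gammaR_eq {r a γ : ℝ} (ha : 0 < a) (har : a < r) (hγ : 0 < γ) (hγ' : γ ≤ 1 / 10)
    (h : gammaR r a = γ) : a ≤ γ / 2 * r := by
  have hr : 0 < r := ha.trans har
  set x := a / r with hx
  have hx1 : x < 1 := (div_lt_one hr).mpr har
  have h1 : 1 / (1 - x) ^ 2 - 1 ≤ γ := h ▸ le_max_right _ _
  have h2 : 1 ≤ (1 + γ) * (1 - x) ^ 2 := by
    rw [← div_le_iff₀ (pow_pos (by linarith) 2)]
    linarith
  rw [← div_le_iff₀ hr, ← hx]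
  by_contra! hlt
  have h3 : (1 - x) ^ 2 ≤ (1 - γ / 2) ^ 2 := pow_le_pow_left₀ (by linarith) (by linarith) 2
  have h4 : (1 + γ) * (1 - x) ^ 2 ≤ (1 + γ) * (1 - γ / 2) ^ 2 := by gcongr
  nlinarith [pow_pos hγ 2, pow_pos hγ 3]

theorem sqrt_two_lt : √2 < 141422 / 100000 := by
  rw [Real.sqrt_lt' (by norm_num)]
  norm_num

/-- The numerical estimates behind the distortion bounds: `t` is the diameter of a reference box,
and `s` the radius at a stage at which no test has applied yet. -/
theorem radius_estimates {γ δ t s : ℝ} (hγ : 0 < γ) (hγ' : γ ≤ 1 / 10) (hδ : 0 < δ)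
    (ht : 0 ≤ t) (hta : t ≤ 5304 / 10000 * γ * δ)
    (htc : 16 * (1 + γ) ^ 2 * t ≤ δ * ((1 - 3 * γ) * (1 - γ))) (hs : s * (1 - 7 * γ) ≤ t) :
    s ≤ 6 / 5 * γ * δ ∧ 3 * s * (1 + γ) + t ≤ 2 * δ / 5 := by
  obtain ⟨t, rfl⟩ : ∃ t', t = t' * δ := ⟨t / δ, (div_mul_cancel₀ _ hδ.ne').symm⟩
  obtain ⟨s, rfl⟩ : ∃ s', s = s' * δ := ⟨s / δ, (div_mul_cancel₀ _ hδ.ne').symm⟩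
  have ht : 0 ≤ t := nonneg_of_mul_nonneg_left ht hδ
  have hta : t ≤ 5304 / 10000 * γ := le_of_mul_le_mul_right hta hδ
  have htc : 16 * (1 + γ) ^ 2 * t ≤ (1 - 3 * γ) * (1 - γ) :=
    le_of_mul_le_mul_right (by linarith) hδ
  have hs : s * (1 - 7 * γ) ≤ t := le_of_mul_le_mul_right (by linarith) hδ
  suffices s ≤ 6 / 5 * γ ∧ 3 * s * (1 + γ) + t ≤ 2 / 5 from
    ⟨by nlinarith, by nlinarith⟩
  have h7 : 0 < 1 - 7 * γ := by linarith
  -- For small `γ` the factor `1 - 7γ` is at least `0.51`, and the bound on `t` coming from `a`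
  -- suffices. Near `γ = 0.1` that factor drops to `0.3`, and the bound coming from `c(γ)` takes
  -- over.
  rcases le_or_gt γ (7 / 100) with h | h
  · have h1 : s ≤ 104 / 100 * γ := by
      by_contra! hlt
      nlinarith
    exact ⟨by linarith, by nlinarith⟩
  · have hγ2 : 0 < 16 * (1 + γ) ^ 2 := by positivity
    have h0 : 16 * (1 + γ) ^ 2 * (s * (1 - 7 * γ)) ≤ (1 - 3 * γ) * (1 - γ) :=
      (mul_le_mul_of_nonneg_left hs hγ2.le).trans htc
    have hpos : 0 < 16 * (1 + γ) ^ 2 * (1 - 7 * γ) := by positivity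
    have h1 : s ≤ 109 / 1000 := by
      refine le_of_mul_le_mul_left (a := 16 * (1 + γ) ^ 2 * (1 - 7 * γ)) ?_ hpos
      nlinarith [mul_nonneg (sub_nonneg.mpr hγ') (sub_nonneg.mpr h.le),
        mul_nonneg (mul_nonneg (sub_nonneg.mpr hγ') (sub_nonneg.mpr h.le)) hγ.le]
    have h2 : s ≤ 6 / 5 * γ := by
      refine le_of_mul_le_mul_left (a := 16 * (1 + γ) ^ 2 * (1 - 7 * γ)) ?_ hpos
      nlinarith [mul_nonneg (sub_nonneg.mpr hγ') (sub_nonneg.mpr h.le),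
        mul_nonneg (mul_nonneg (sub_nonneg.mpr hγ') (sub_nonneg.mpr h.le)) hγ.le,
        mul_nonneg (mul_nonneg (sub_nonneg.mpr hγ') (sub_nonneg.mpr h.le)) (sq_nonneg γ)]
    have h3 : t ≤ 402 / 10000 := by
      refine le_of_mul_le_mul_left (a := 16 * (1 + γ) ^ 2) ?_ hγ2
      nlinarith
    refine ⟨h2, ?_⟩
    nlinarith

theorem zpow_sub_two_eq (N : ℕ) : (2 : ℝ) ^ (-(N : ℤ) - 2) = 2 * sigma N := by
  rw [sigma, show -(N : ℤ) - 2 = 1 + (-(N : ℤ) - 3) by ring, zpow_add₀ two_ne_zero, zpow_one]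

theorem zpow_sub_one_eq (N : ℕ) : (2 : ℝ) ^ (-(N : ℤ) - 1) = 4 * sigma N := by
  rw [sigma, show -(N : ℤ) - 1 = 2 + (-(N : ℤ) - 3) by ring, zpow_add₀ two_ne_zero]
  norm_num

theorem zpow_neg_eq (N : ℕ) : (2 : ℝ) ^ (-(N : ℤ)) = 8 * sigma N := by
  rw [sigma, show -(N : ℤ) = 3 + (-(N : ℤ) - 3) by ring, zpow_add₀ two_ne_zero]
  norm_num

theorem sigma_pos (N : ℕ) : 0 < sigma N := by
  unfold sigma
  positivity

theorem two_pow_mul_sigma (N : ℕ) : (2 : ℝ) ^ (N + 3) * sigma N = 1 := by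
  rw [sigma, ← zpow_natCast, ← zpow_add₀ two_ne_zero]
  simp

/-! ### Correctness of the reported value at one ideal point -/

section Algorithm

variable {p : ℂ[X]} {A : StepOneA} {B : StepOneB}

/-- The `k`-th iterate of `z` is close to the Julia set, on the scale of the boxes, and the
radius of the image of a pixel is not larger than the scale of the boxes. -/
def IsNearStage (p : ℂ[X]) (A : StepOneA) (B : StepOneB) (N : ℕ) (z : ℂ) (k : ℕ) : Prop :=
  (∃ ζ ∈ julia p, ‖(A.g p)^[k] z - ζ‖ ≤
    3 * (‖deriv ((A.g p)^[k]) z‖ * sigma N) * (1 + B.γ) + √2 * B.β) ∧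
  ‖deriv ((A.g p)^[k]) z‖ * sigma N * (1 - 7 * B.γ) ≤ √2 * B.β

/-- The constants fit the distortion lemmas: `5/(24δ) · 4 · (6/5)γδ = γ`, and `2δ/5` is the distance
to `J` allowed in `expansion_of_deriv_modulus`. -/
theorem IsNearStage.estimates (hA : IsStepOneA p A) (hB : IsStepOneB p A B) {N : ℕ} {z : ℂ}
    {k : ℕ} (h : IsNearStage p A B N z k) :
    ‖deriv ((A.g p)^[k]) z‖ * sigma N ≤ 6 / 5 * B.γ * A.δ ∧
      ∃ ζ ∈ julia p, ‖(A.g p)^[k] z - ζ‖ ≤ 2 * A.δ / 5 := by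
  have hδ := hA.δ_pos
  have hγ := hB.γ_pos
  have hβ := hB.β_pos
  have h2 : 0 < √2 := by positivity
  have hβa : B.β < B.a := hB.β_lt.trans_le (min_le_right _ _)
  have hβc : B.β < A.δ * cGamma B.γ / (16 * √2 * (1 + B.γ)) := hB.β_lt.trans_le (min_le_left _ _)
  have ha := le_of_gammaR_eq hB.a_pos hB.a_lt hγ hB.γ_le hB.gamma_eq
  have hta : √2 * B.β ≤ 5304 / 10000 * B.γ * A.δ := by
    have h3 : B.β ≤ 3 / 8 * (B.γ * A.δ) := by linarith
    have h4 : √2 * B.β ≤ 141422 / 100000 * (3 / 8 * (B.γ * A.δ)) :=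
      mul_le_mul sqrt_two_lt.le h3 hβ.le (by norm_num)
    nlinarith [mul_pos hγ hδ]
  have htc : 16 * (1 + B.γ) ^ 2 * (√2 * B.β) ≤
      A.δ * ((1 - 3 * B.γ) * (1 - B.γ)) := by
    rw [lt_div_iff₀ (by positivity)] at hβc
    have h3 : cGamma B.γ * (1 + B.γ) = (1 - 3 * B.γ) * (1 - B.γ) :=
      div_mul_cancel₀ _ (by linarith)
    rw [← h3]
    nlinarith
  obtain ⟨⟨ζ, hζ, hzζ⟩, hs⟩ := h
  obtain ⟨h5, h6⟩ := radius_estimates hγ hB.γ_le hδ (by positivity) hta htc hs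
  exact ⟨h5, ζ, hζ, hzζ.trans h6⟩

theorem IsNearStage.mem_N1 (hA : IsStepOneA p A) (hB : IsStepOneB p A B) {N : ℕ} {z : ℂ}
    {k : ℕ} (h : IsNearStage p A B N z k) : (A.g p)^[k] z ∈ A.N1 := by
  obtain ⟨-, ζ, hζ, hzζ⟩ := h.estimates hA hB
  exact ⟨ζ, hA.julia_subset hζ, (supDist_le_norm _ _).trans_lt (by linarith [hA.δ_pos])⟩

theorem pow_lt_norm_deriv_iterate (hA : IsStepOneA p A) (hB : IsStepOneB p A B) {N : ℕ} {z : ℂ}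
    {k : ℕ} (h : ∀ j ≤ k, IsNearStage p A B N z j) :
    A.L ^ (k + 1) < ‖deriv ((A.g p)^[k + 1]) z‖ := by
  have hL : 0 < A.L := by
    have := hA.lam_pos
    unfold StepOneA.L
    positivity
  have hexp : ∀ j ≤ k, A.L < ‖deriv (A.g p) ((A.g p)^[j] z)‖ := fun j hj =>
    hA.expanding_N1 _ ((h j hj).mem_N1 hA hB)
  have key : ∀ j ≤ k + 1, A.L ^ j ≤ ‖deriv ((A.g p)^[j]) z‖ := fun j => by
    induction j with
    | zero => simp
    | succ j ih =>
      intro hj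
      rw [deriv_g_iterate_succ, pow_succ]
      exact mul_le_mul (ih (by omega)) (hexp j (by omega)).le hL.le (norm_nonneg _)
  rw [deriv_g_iterate_succ, pow_succ]
  exact mul_lt_mul' (key k (by omega)) (hexp k le_rfl) hL.le
    ((pow_pos hL k).trans_le (key k (by omega)))

/-- Distortion of the iterates up to a stage before which no test has applied. -/
theorem distortion_of_isNearStage (hA : IsStepOneA p A) (hB : IsStepOneB p A B) {N : ℕ} {z : ℂ}
    {k : ℕ} (h : ∀ j ≤ k, IsNearStage p A B N z j) {w : ℂ} (hw : ‖w - z‖ ≤ 4 * sigma N) :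
    0 < ‖deriv ((A.g p)^[k + 1]) z‖ ∧
      (1 - B.γ) * (‖deriv ((A.g p)^[k + 1]) z‖ * ‖w - z‖) ≤
        ‖(A.g p)^[k + 1] w - (A.g p)^[k + 1] z‖ ∧
      ‖(A.g p)^[k + 1] w - (A.g p)^[k + 1] z‖ * (1 - B.γ) ≤
        ‖deriv ((A.g p)^[k + 1]) z‖ * ‖w - z‖ := by
  have hδ := hA.δ_pos
  have hsmall : ∀ j ≤ k, 5 / (24 * A.δ) * ‖w - z‖ * ‖deriv ((A.g p)^[j]) z‖ ≤ B.γ :=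
    fun j hj => by
      have h1 := ((h j hj).estimates hA hB).1
      have h2 : ‖w - z‖ * ‖deriv ((A.g p)^[j]) z‖ ≤
          4 * sigma N * ‖deriv ((A.g p)^[j]) z‖ := by gcongr
      rw [mul_assoc, div_mul_eq_mul_div, div_le_iff₀ (by positivity)]
      nlinarith
  obtain ⟨hD, T, -, -, hT, hlow, hup⟩ := exists_distortion_iterate (differentiable_g p A) hδ
    hA.lam_pos (z := z) (w := w) (k := k + 1)
    (fun j hj => by
      obtain ⟨-, ζ, hζ, hzζ⟩ := (h j (by omega)).estimates hA hB
      exact expansion_of_deriv_modulus (differentiable_g p A) hδ hA.lam_pos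
        (fun y hy => hA.modulus ζ (hA.julia_subset hζ) y ((supDist_le_norm y ζ).trans_lt hy))
        (hA.expanding ζ (hA.julia_subset hζ)) hzζ)
    (fun j hj => (hsmall j (by omega)).trans hB.γ_le)
  have hTγ : T ≤ B.γ := (hT k rfl).le.trans (hsmall k le_rfl)
  refine ⟨hD, le_trans ?_ hlow, le_trans ?_ hup⟩ <;> gcongr

theorem sqrt_two_mul_sigma_le (N : ℕ) : √2 * (2 * sigma N) ≤ 4 * sigma N := by
  nlinarith [sqrt_two_lt, sigma_pos N]

/-- The value `v` is allowed for the ideal point `z` at precision `N`. -/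
def IsAllowed (p : ℂ[X]) (N : ℕ) (z : ℂ) (v : Fin 2) : Prop :=
  (v = 1 → ∃ w ∈ julia p, supDist z w < 4 * sigma N) ∧
    (v = 0 → ∀ w ∈ julia p, ¬ supDist z w < 2 * sigma N)

/-- The test at stage `k + 1` is conclusive and correct, or the orbit is still close to the Julia
set. -/
theorem stepTwoTest_spec (hdeg : 2 ≤ p.natDegree) (hA : IsStepOneA p A) (hB : IsStepOneB p A B)
    {N : ℕ} {z : ℂ} {k : ℕ} (h : ∀ j ≤ k, IsNearStage p A B N z j) :
    (∃ v, stepTwoTest p A B N z (k + 1) = some v ∧ IsAllowed p N z v) ∨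
      (stepTwoTest p A B N z (k + 1) = none ∧ IsNearStage p A B N z (k + 1) ∧
        ‖deriv ((A.g p)^[k + 1]) z‖ * sigma N * cGamma B.γ ≤ 2 * B.β * √2) := by
  have hγ := hB.γ_pos
  have hγ' := hB.γ_le
  have hσ := sigma_pos N
  have hD : 0 < ‖deriv ((A.g p)^[k + 1]) z‖ :=
    (distortion_of_isNearStage hA hB h (w := z) (by simp [hσ.le])).1
  unfold stepTwoTest
  simp only
  set D := ‖deriv ((A.g p)^[k + 1]) z‖ with hDdef
  set f := (A.g p)^[k + 1] with hf
  split_ifs with h1 h2 h3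
  -- A point of `J` within `2σ` in the box metric has Euclidean distance at most `2√2 σ`, and its
  -- image would lie in the ball of the test because `3(1-γ²) ≥ 2.97 > 2√2`.
  · refine Or.inl ⟨0, rfl, by simp, fun _ w hw hzw => ?_⟩
    have hwz : ‖w - z‖ ≤ √2 * (2 * sigma N) := by
      refine (norm_le_supDist w z).trans ?_
      rw [supDist_comm]
      gcongr
    obtain ⟨-, -, hup⟩ := distortion_of_isNearStage hA hB h (hwz.trans (sqrt_two_mul_sigma_le N))
    refine Set.disjoint_left.mp h1 ?_
      (hB.julia_subset ((g_iterate_mem_julia hdeg A (k + 1)).mpr hw))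
    rw [Metric.mem_ball, dist_eq_norm]
    by_contra! hge
    have h4 : D * (3 * sigma N) * (1 + B.γ) * (1 - B.γ) ≤ D * (√2 * (2 * sigma N)) :=
      (mul_le_mul_of_nonneg_right hge (by linarith)).trans
        (hup.trans (mul_le_mul_of_nonneg_left hwz hD.le))
    have h5 : 0 < D * sigma N := mul_pos hD hσ
    have h6 : D * sigma N * (3 * ((1 + B.γ) * (1 - B.γ))) ≤ D * sigma N * (√2 * 2) := by
      linarith
    have h7 := le_of_mul_le_mul_left h6 h5
    nlinarith [sqrt_two_lt]
  · refine Or.inl ⟨1, rfl, fun _ => ?_, by simp⟩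
    obtain ⟨q, hq, hqb⟩ := h2
    obtain ⟨y, hyq, hyJ⟩ := hB.meets_julia q hq
    have hball := ball_subset_image_ball (differentiable_g_iterate p A (k + 1)).continuous
      (isOpenMap_g_iterate hdeg A (k + 1)) (z := z) (s := 4 * sigma N)
      (m := D * (4 * sigma N) * (1 - B.γ)) (by positivity) (fun w hw => by
        obtain ⟨-, hlow, -⟩ := distortion_of_isNearStage hA hB h hw.le
        rw [hw] at hlow
        linarith)
    -- A point of `J` in the reference box is pulled back to a point within `4σ` of `z`, which lies
    -- in `J` by complete invariance.
    obtain ⟨w, hw, rfl⟩ := hball (hqb hyq)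
    rw [Metric.mem_ball, dist_comm, dist_eq_norm] at hw
    exact ⟨w, (g_iterate_mem_julia hdeg A (k + 1)).mp hyJ, (supDist_le_norm z w).trans_lt hw⟩
  all_goals
    obtain ⟨n, hn, hnN⟩ := Set.not_disjoint_iff.mp h1
    simp only [StepOneB.N2, Set.mem_iUnion] at hnN
    obtain ⟨q, hq, hnq⟩ := hnN
    obtain ⟨ζ, hζq, hζ⟩ := hB.meets_julia q hq
    have hnot : ¬ B.refBox q ⊆ Metric.ball (f z) (D * (4 * sigma N) * (1 - B.γ)) :=
      fun hsub => h2 ⟨q, hq, hsub⟩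
    obtain ⟨m, hmq, hm⟩ := Set.not_subset.mp hnot
    rw [Metric.mem_ball, dist_eq_norm, norm_sub_rev] at hn
    rw [Metric.mem_ball, dist_eq_norm, norm_sub_rev, not_lt] at hm
    have hnm := norm_sub_le_norm_sub_add_norm_sub (f z) n m
    have hnζ := norm_sub_le_norm_sub_add_norm_sub (f z) n ζ
    have hs : D * sigma N * (1 - 7 * B.γ) ≤ √2 * B.β := by
      linarith [norm_sub_le_of_mem_closedBox hnq hmq]
    have hc : D * sigma N * cGamma B.γ ≤ 2 * B.β * √2 := by
      have := mul_le_mul_of_nonneg_left (cGamma_le hγ hγ') (mul_pos hD hσ).le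
      linarith
  -- Since `c(γ) ≤ 2(1-7γ)`, failure of the first two tests already rules out the third.
  · exact absurd h3 (not_lt.mpr hc)
  · refine Or.inr ⟨rfl, ⟨⟨ζ, hζ, ?_⟩, hs⟩, hc⟩
    linarith [norm_sub_le_of_mem_closedBox hnq hζq]

theorem stepTwo_isAllowed (hdeg : 2 ≤ p.natDegree) (hA : IsStepOneA p A) (hB : IsStepOneB p A B)
    {N : ℕ} {z : ℂ} (h : IsNearStage p A B N z 0) (hβ : 2 * sigma N ≤ B.β * √2) :
    IsAllowed p N z (stepTwo p A B N z) := by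
  have hσ := sigma_pos N
  have hc := cGamma_pos hB.γ_pos hB.γ_le
  have hL : 1 < A.L := by
    have := hA.lam_pos
    unfold StepOneA.L
    linarith
  have hlogL : 0 < Real.logb 2 A.L := Real.logb_pos one_lt_two hL
  have hβ0 := hB.β_pos
  set Y : ℝ := 2 * B.β * √2 / cGamma B.γ with hY
  have hY0 : 0 < Y := by positivity
  have hlog : (N : ℝ) + 3 + Real.logb 2 Y = Real.logb 2 (2 ^ (N + 3) * Y) := by
    rw [Real.logb_mul (by positivity) hY0.ne', Real.logb_pow, Real.logb_self_eq_one one_lt_two]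
    push_cast
    ring
  have hYσ : 2 ^ (N + 3) * Y * (sigma N * cGamma B.γ) = 2 * B.β * √2 := by
    have h1 : Y * cGamma B.γ = 2 * B.β * √2 := div_mul_cancel₀ _ hc.ne'
    linear_combination (2 * B.β * √2) * two_pow_mul_sigma N + 2 ^ (N + 3) * sigma N * h1
  -- This excludes `k_N = 0`, since `L ^ k_N` is at least the right-hand side.
  have hYone : 1 < 2 ^ (N + 3) * Y := by
    by_contra! hle
    have h1 : 2 ^ (N + 3) * Y * (sigma N * cGamma B.γ) ≤ 1 * (sigma N * 1) := by
      gcongr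
      exact cGamma_le_one hB.γ_pos hB.γ_le
    linarith
  have hk := Nat.le_ceil (1 / Real.logb 2 A.L * (N + 3 + Real.logb 2 Y))
  change _ ≤ (kMax A B N : ℝ) at hk
  rw [hlog, one_div_mul_eq_div, div_le_iff₀ hlogL, ← Real.logb_pow,
    Real.logb_le_logb one_lt_two (by positivity) (by positivity)] at hk
  have key : ∀ k : ℕ,
      (∃ v, ((List.range k).findSome? fun i => stepTwoTest p A B N z (i + 1)) = some v ∧
        IsAllowed p N z v) ∨
      (((List.range k).findSome? fun i => stepTwoTest p A B N z (i + 1)) = none ∧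
        (∀ j ≤ k, IsNearStage p A B N z j) ∧ ∀ j, k = j + 1 →
          ‖deriv ((A.g p)^[j + 1]) z‖ * sigma N * cGamma B.γ ≤ 2 * B.β * √2) := fun k => by
    induction k with
    | zero => exact Or.inr ⟨rfl, fun j hj => by rwa [Nat.le_zero.mp hj], by simp⟩
    | succ k ih =>
      rw [List.range_succ, List.findSome?_append]
      rcases ih with ⟨v, hv, hv'⟩ | ⟨hnone, hnear, -⟩
      · exact Or.inl ⟨v, by simp [hv], hv'⟩
      · rcases stepTwoTest_spec hdeg hA hB hnear with ⟨v, hv, hv'⟩ | ⟨hv, hnear', hc'⟩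
        · exact Or.inl ⟨v, by simp [hnone, hv], hv'⟩
        · refine Or.inr ⟨by simp [hnone, hv], fun j hj => ?_, fun j hj => ?_⟩
          · rcases Nat.lt_or_eq_of_le hj with hj | rfl
            · exact hnear j (by omega)
            · exact hnear'
          · obtain rfl : k = j := by omega
            exact hc'
  unfold stepTwo
  rcases key (kMax A B N) with ⟨v, hv, hv'⟩ | ⟨-, hnear, hlast⟩
  · rw [hv]
    exact hv'
  -- If no test applied, the choice of `k_N` and the strict bound `L ^ k_N < D` would give `2β√2 <
  -- Dσc`, against the bound kept from the last stage.
  · exfalso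
    rcases Nat.eq_zero_or_eq_succ_pred (kMax A B N) with h0 | h0
    · rw [h0, pow_zero] at hk
      linarith
    · obtain ⟨k, hkk⟩ : ∃ k, kMax A B N = k + 1 := ⟨_, h0⟩
      have h1 := pow_lt_norm_deriv_iterate hA hB (N := N) (z := z) (k := k)
        (fun j hj => hnear j (by omega))
      have h2 := hlast k hkk
      rw [hkk] at hk
      have h3 := mul_lt_mul_of_pos_right (hk.trans_lt h1) (mul_pos hσ hc)
      linarith

theorem report_isAllowed (hdeg : 2 ≤ p.natDegree) (hA : IsStepOneA p A) (hB : IsStepOneB p A B)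
    {N : ℕ} (z : ℂ) : IsAllowed p N z (report p A B N z) := by
  have hσ := sigma_pos N
  have hσ1 : 2 * sigma N ≤ 1 := by
    rw [← zpow_sub_two_eq]
    exact zpow_le_one_of_nonpos₀ one_le_two (by omega)
  unfold report
  rw [zpow_sub_two_eq, zpow_sub_one_eq]
  by_cases h1 : z ∉ closedBox 0 (A.R + 1)
  · rw [if_pos h1]
    refine ⟨by simp, fun _ w hw hzw => h1 ?_⟩
    have h5 : supDist w 0 ≤ A.R := hA.julia_subset_R hw
    have h6 := supDist_triangle z w 0
    change supDist z 0 ≤ A.R + 1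
    linarith
  rw [if_neg h1]
  split_ifs with h2 h3 h4
  · refine ⟨by simp, fun _ w hw hzw => ?_⟩
    have : w ∈ B.N2 ∩ closedBox z (2 * sigma N) :=
      ⟨hB.julia_subset hw, by rw [supDist_comm] at hzw; exact hzw.le⟩
    rw [h2] at this
    exact this
  · refine ⟨fun _ => ?_, by simp⟩
    obtain ⟨q, hq, hqb⟩ := h3
    obtain ⟨y, hyq, hyJ⟩ := hB.meets_julia q hq
    exact ⟨y, hyJ, by rw [supDist_comm]; exact hqb hyq⟩
  all_goals
    obtain ⟨n, hnN, hn⟩ := Set.nonempty_iff_ne_empty.mpr h2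
    simp only [StepOneB.N2, Set.mem_iUnion] at hnN
    obtain ⟨q, hq, hnq⟩ := hnN
    have hn' : supDist n z ≤ 2 * sigma N := hn
    have hnot : ¬ B.refBox q ⊆ openBox z (4 * sigma N) := fun hsub => h3 ⟨q, hq, hsub⟩
    obtain ⟨m, hmq, hm⟩ := Set.not_subset.mp hnot
    have hm' : 4 * sigma N ≤ supDist m z := not_lt.mp hm
    have hβσ : 2 * sigma N ≤ B.β := by
      linarith [supDist_triangle m n z, supDist_le_of_mem_closedBox hmq hnq]
    have hsqrt : 1 ≤ √2 := Real.one_le_sqrt.mpr one_le_two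
  -- The base-case size test cannot apply: a box meeting the closed box of radius `2σ` but leaving
  -- the open one of radius `4σ` has side-length at least `2σ`.
  · nlinarith
  · refine stepTwo_isAllowed hdeg hA hB ?_ (not_lt.mp h4)
    have hγ := hB.γ_pos
    obtain ⟨ζ, hζq, hζ⟩ := hB.meets_julia q hq
    refine ⟨⟨ζ, hζ, ?_⟩, ?_⟩
    · have h5 := norm_sub_le_norm_sub_add_norm_sub z n ζ
      have h6 := norm_sub_le_of_mem_closedBox hnq hζq
      have h7 := norm_le_supDist n z
      rw [norm_sub_rev] at h7
      have h8 : √2 * supDist n z ≤ √2 * (2 * sigma N) := by gcongr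
      have h9 : √2 * (2 * sigma N) ≤ 3 * sigma N := by nlinarith [sqrt_two_lt]
      have h10 : 3 * sigma N ≤ 3 * sigma N * (1 + B.γ) := by nlinarith
      simp only [Function.iterate_zero, deriv_id', norm_one, one_mul, id]
      linarith
    · simp only [Function.iterate_zero, deriv_id', norm_one, one_mul]
      nlinarith

theorem report_isValidAt (hdeg : 2 ≤ p.natDegree) (hA : IsStepOneA p A) (hB : IsStepOneB p A B)
    (N : ℕ) : IsValidAt (julia p) N (report p A B N) := by
  intro z _
  obtain ⟨h1, h0⟩ := report_isAllowed hdeg hA hB (N := N) z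
  have hne := julia_nonempty hdeg
  have hcases : report p A B N z = 0 ∨ report p A B N z = 1 := by
    generalize report p A B N z = v
    fin_cases v <;> simp
  rw [zpow_sub_two_eq, zpow_sub_one_eq]
  constructor
  · intro hz
    obtain ⟨w, hw, hzw⟩ := (supInfDist_lt_iff hne).mp hz
    exact hcases.resolve_left fun h => h0 h w hw hzw
  · intro hz
    exact hcases.resolve_right fun h => not_lt.mpr hz ((supInfDist_lt_iff hne).mpr (h1 h))

end Algorithm

/-! ### Pictures -/

/-- The picture drawn according to a valid function is a good approximation. -/
theorem IsValidAt.isApproximation_picture {C : Set ℂ} (hC : C.Nonempty) {n : ℕ} {h : ℂ → Fin 2}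
    (hh : IsValidAt C n h) : IsApproximation n C (picture n h) := by
  have hσ := sigma_pos n
  unfold IsApproximation
  refine Metric.hausdorffEDist_le_of_mem_edist ?_ ?_
  · rintro _ ⟨w, hw, rfl⟩
    refine ⟨toPlane w, ⟨w, ?_, rfl⟩, by simp⟩
    obtain ⟨i, hi⟩ := exists_gridPoint_supDist_le (s := 2 * sigma n) (by positivity) w
    have hmem : gridPoint (2 * sigma n) i ∈ idealPoints n := by
      refine ⟨i.1, i.2, ?_⟩
      have : 2 * sigma n = (2 ^ (n + 2))⁻¹ := by
        rw [← zpow_sub_two_eq, ← zpow_natCast, ← zpow_neg]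
        congr 1
        push_cast
        ring
      simp only [gridPoint, this, div_eq_mul_inv]
    have hi' : supDist w (gridPoint (2 * sigma n) i) ≤ sigma n := by linarith
    refine Set.mem_biUnion (x := gridPoint (2 * sigma n) i) ⟨hmem, (hh _ hmem).1 ?_⟩ hi'
    rw [zpow_sub_two_eq, supInfDist_lt_iff hC]
    refine ⟨w, hw, ?_⟩
    rw [supDist_comm]
    linarith
  · rintro _ ⟨v, hv, rfl⟩
    simp only [picture, Set.mem_iUnion] at hv
    obtain ⟨z, ⟨hz, hz1⟩, hvz⟩ := hv
    have hvz' : supDist v z ≤ sigma n := hvz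
    have hzC : supInfDist z C < 4 * sigma n := by
      by_contra! hge
      rw [← zpow_sub_one_eq] at hge
      rw [(hh z hz).2 hge] at hz1
      simp at hz1
    obtain ⟨w, hw, hzw⟩ := (supInfDist_lt_iff hC).mp hzC
    refine ⟨toPlane w, ⟨w, hw, rfl⟩, ?_⟩
    rw [edist_dist, ← supDist_eq, zpow_neg_eq]
    -- A pixel contributes `σ` and its centre is within `4σ` of `C`: in total `5σ`, below the
    -- permitted `8σ`.
    exact ENNReal.ofReal_le_ofReal (by linarith [supDist_triangle v z w])

theorem IsApproximation.mono {C Ψ : Set ℂ} {m n : ℕ} (hmn : m ≤ n) (h : IsApproximation n C Ψ) :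
    IsApproximation m C Ψ :=
  h.trans (ENNReal.ofReal_le_ofReal (zpow_le_zpow_right₀ one_le_two (by omega)))

end HypJulia

theorem mainTheorem5 (p : Polynomial ℂ) (hdeg : 2 ≤ p.natDegree)
    (hp : HypJulia.IsHyperbolic p) :
    -- the precomputation has admissible outputs, whatever `γ` is chosen
    (∃ A, HypJulia.IsStepOneA p A) ∧
    (∀ A, HypJulia.IsStepOneA p A → ∀ γ : ℝ, 0 < γ → γ ≤ 1 / 10 →
      ∃ B, B.γ = γ ∧ HypJulia.IsStepOneB p A B) ∧
    -- and after each of them the algorithm is correct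
    (∀ A, HypJulia.IsStepOneA p A → ∀ B, HypJulia.IsStepOneB p A B →
      (∀ N : ℕ, B.Nmin ≤ N →
        HypJulia.IsValidAt (HypJulia.julia p) N (HypJulia.report p A B N)) ∧
      (∀ N : ℕ,
        HypJulia.IsApproximation N (HypJulia.julia p) (HypJulia.drawnPicture p A B N))) :=
  ⟨HypJulia.exists_isStepOneA hdeg hp,
    fun _ hA _ hγ hγ' => HypJulia.exists_isStepOneB hdeg hA hγ hγ',
    fun _ hA _ hB => ⟨fun N _ => HypJulia.report_isValidAt hdeg hA hB N,
      fun N => ((HypJulia.report_isValidAt hdeg hA hB _).isApproximation_picture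
        (HypJulia.julia_nonempty hdeg)).mono (le_max_left N _)⟩⟩
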